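/- All rings are commutative with identity. Let $R$ be a ring, and write $M^*=\operatorname{Hom}_R(M,R)$ for an $R$-module $M$. The ring $R$ is *coherent* if every finitely generated ideal of $R$ is finitely presented. A finitely generated $R$-module $M$ is in the *G-class* of $R$ if $\operatorname{Ext}^i_R(M,R)=0$ and $\operatorname{Ext}^i_R(M^*,R)=0$ for all $i>0$ and the natural map $M\to M^{**}$ is an isomorphism. A *G-resolution* of $M$ is an exact sequence $\cdots\to G_1\to G_0\to M\to 0$ with every $G_n$ in the G-class of $R$; its *length* is $\sup\{n : G_n\neq 0\}$ (and $0$ if all $G_n$ are zero). The *G-dimension* of $M$ is the infimum of the lengths of all G-resolutions of $M$; it is finite exactly when $M$ has a G-resolution of finite length. A quasi-local ring (a ring with a unique maximal ideal, not necessarily Noetherian) is *Gorenstein* if each of its finitely generated ideals has finite G-dimension. An arbitrary ring $R$ is *Gorenstein* if the localization $R_{\mathfrak m}$ is Gorenstein for every maximal ideal $\mathfrak m$ of $R$. **Proposition 5.11.** Let $\{R_i\}_{i\in\Lambda}$ be a direct system of commutative rings over a (nonempty) directed index set $\Lambda$. Suppose that each $R_i$ is a coherent Gorenstein ring and that the maps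 $R_i\to R_j$ are flat for all $i\le j$. Then $\varinjlim R_i$ is a coherent Gorenstein ring. -/

import Mathlib

open CategoryTheory

universe u

/-- A commutative ring is coherent if every finitely generated ideal is finitely presented. -/
def IsCoherentRing (R : Type u) [CommRing R] : Prop :=
  ∀ I : Ideal R, I.FG → Module.FinitePresentation R I

/-- `Ext^i_R(M, R) = 0` for all `i > 0`. -/
def ExtToRingVanishes (R : Type u) [CommRing R] (M : Type u) [AddCommGroup M] [Module R M] :
    Prop :=
  ∀ i : ℕ, 0 < i → Subsingleton (Abelian.Ext (ModuleCat.of R M) (ModuleCat.of R R) i)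

/-- Membership in the G-class of `R`. The last field says that the natural map
`M → M**` is bijective. -/
structure IsGClass (R : Type u) [CommRing R] (M : Type u) [AddCommGroup M] [Module R M] :
    Prop where
  finite : Module.Finite R M
  ext_vanishes : ExtToRingVanishes R M
  ext_dual_vanishes : ExtToRingVanishes R (Module.Dual R M)
  reflexive : Function.Bijective (Module.Dual.eval R M)

/-- A G-resolution of `M`: an exact sequence `⋯ → X 1 → X 0 → M → 0` in which every
`X n` belongs to the G-class of `R`. -/
structure GResolution (R : Type u) [CommRing R] (M : Type u) [AddCommGroup M] [Module R M] where
  X : ℕ → ModuleCat.{u} R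
  isGClass : ∀ n, IsGClass R (X n)
  d : ∀ n, X (n + 1) →ₗ[R] X n
  ε : X 0 →ₗ[R] M
  exact_d : ∀ n, Function.Exact (d (n + 1)) (d n)
  exact_ε : Function.Exact (d 0) ε
  surjective_ε : Function.Surjective ε

/-- The length of a G-resolution: the supremum of the `n` with `X n ≠ 0`
(zero if there is no such `n`). -/
noncomputable def GResolution.length {R : Type u} [CommRing R] {M : Type u} [AddCommGroup M]
    [Module R M] (G : GResolution R M) : ℕ∞ :=
  ⨆ (n : ℕ) (_ : Nontrivial (G.X n)), (n : ℕ∞)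

/-- The G-dimension of `M`: the infimum of the lengths of the G-resolutions of `M`.
It is `⊤` if `M` has no G-resolution or only G-resolutions of infinite length. -/
noncomputable def gDim (R : Type u) [CommRing R] (M : Type u) [AddCommGroup M] [Module R M] :
    ℕ∞ :=
  ⨅ G : GResolution R M, G.length

/-- A quasi-local ring is Gorenstein if every finitely generated ideal has finite G-dimension. -/
def IsGorensteinLocalRing (R : Type u) [CommRing R] [IsLocalRing R] : Prop :=
  ∀ I : Ideal R, I.FG → gDim R I < ⊤

/-- A commutative ring is Gorenstein if its localization at every maximal ideal is a
Gorenstein quasi-local ring. -/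
def IsGorensteinRing (R : Type u) [CommRing R] : Prop :=
  ∀ (m : Ideal R) [m.IsMaximal], IsGorensteinLocalRing (Localization.AtPrime m)

/-! A finitely generated ideal of the limit, or of its localization at a maximal ideal, is extended
from a finitely generated ideal `J` of some `R i` (`Ring.DirectLimit.exists_fg_map_eq`,
`IsLocalization.exists_fg_map_eq`). Since `R i` maps flatly to the limit
(`Ring.DirectLimit.flat_of`), the extension is a base change of `J`, hence finitely presented: this
is coherence. For the Gorenstein property, the map from `R i` to the local ring factors through a
localization of `R i` at a maximal ideal, over which the extension of `J` has finite G-dimension.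

It remains to see that finite G-dimension of a finitely presented module over a coherent ring
survives flat base change (`HasResolution.tensorProduct`). The terms of a G-resolution need not be
finitely presented a priori, so it is not tensored directly. It is traded for one with finite free
terms, ending in a finitely presented syzygy that a Schanuel-type argument shows to be totally
reflexive (`HasResolution.syzygy`). For finitely presented modules over a coherent ring, vanishing
of Ext into the ring and biduality pass to flat algebras (`ExtToRingVanishes.tensorProduct`,
`Module.Dual.eval_tensorProduct_bijective`). -/

open scoped TensorProduct

universe v

/-! ### Ext vanishing and total reflexivity in short exact sequences -/

section ShortExact

variable {R : Type u} [CommRing R] {X Y Z : Type u} [AddCommGroup X] [Module R X]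
  [AddCommGroup Y] [Module R Y] [AddCommGroup Z] [Module R Z]
  {i : X →ₗ[R] Y} {p : Y →ₗ[R] Z}

theorem ModuleCat.shortExact_of_exact (hi : Function.Injective i) (he : Function.Exact i p)
    (hp : Function.Surjective p) :
    (ShortComplex.mk (ModuleCat.ofHom i) (ModuleCat.ofHom p)
      (by ext x; exact he.apply_apply_eq_zero x)).ShortExact where
  exact := (ShortComplex.ShortExact.moduleCat_exact_iff_function_exact _).2 he
  mono_f := (ModuleCat.mono_iff_injective _).2 hi
  epi_g := (ModuleCat.epi_iff_surjective _).2 hp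

theorem ExtToRingVanishes.of_projective [Module.Projective R X] : ExtToRingVanishes R X := by
  intro n hn
  obtain ⟨n, rfl⟩ := Nat.exists_eq_succ_of_ne_zero hn.ne'
  exact subsingleton_of_forall_eq 0 Abelian.Ext.eq_zero_of_projective

theorem ExtToRingVanishes.left (hi : Function.Injective i) (he : Function.Exact i p)
    (hp : Function.Surjective p) (hY : ExtToRingVanishes R Y) (hZ : ExtToRingVanishes R Z) :
    ExtToRingVanishes R X := by
  intro n hn
  have h := ModuleCat.shortExact_of_exact hi he hp
  refine subsingleton_of_forall_eq 0 fun x => ?_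
  obtain ⟨y, rfl⟩ := Abelian.Ext.contravariant_sequence_exact₁ h _ x rfl
    (@Subsingleton.elim _ (hZ (1 + n) (by omega)) _ _)
  rw [@Subsingleton.elim _ (hY n hn) y 0, Abelian.Ext.comp_zero]

theorem ExtToRingVanishes.middle (hi : Function.Injective i) (he : Function.Exact i p)
    (hp : Function.Surjective p) (hX : ExtToRingVanishes R X) (hZ : ExtToRingVanishes R Z) :
    ExtToRingVanishes R Y := by
  intro n hn
  have h := ModuleCat.shortExact_of_exact hi he hp
  refine subsingleton_of_forall_eq 0 fun y => ?_
  obtain ⟨z, rfl⟩ := Abelian.Ext.contravariant_sequence_exact₂ h _ y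
    (@Subsingleton.elim _ (hX n hn) _ _)
  rw [@Subsingleton.elim _ (hZ n hn) z 0, Abelian.Ext.comp_zero]

/-- As `Ext¹(Y, R) = 0`, every class in `Ext¹(Z, R)` is the connecting image of a linear form on
`X`, and forms that extend to `Y` have zero image. -/
theorem subsingleton_ext_one_of_dualMap_surjective (hi : Function.Injective i)
    (he : Function.Exact i p) (hp : Function.Surjective p) (hY : ExtToRingVanishes R Y)
    (hd : Function.Surjective i.dualMap) :
    Subsingleton (Abelian.Ext (ModuleCat.of R Z) (ModuleCat.of R R) 1) := by
  have h := ModuleCat.shortExact_of_exact hi he hp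
  refine subsingleton_of_forall_eq 0 fun z => ?_
  obtain ⟨x, rfl⟩ := Abelian.Ext.contravariant_sequence_exact₃ h _ z
    (@Subsingleton.elim _ (hY 1 one_pos) _ _) (add_zero 1)
  obtain ⟨φ, rfl⟩ := (Abelian.Ext.mk₀_bijective _ _).2 x
  obtain ⟨ψ, hψ⟩ := hd φ.hom
  have : φ = ModuleCat.ofHom i ≫ ModuleCat.ofHom ψ := by
    ext1; exact hψ.symm
  rw [this, ← Abelian.Ext.mk₀_comp_mk₀, ← Abelian.Ext.comp_assoc_of_second_deg_zero]
  have h0 : h.extClass.comp (Abelian.Ext.mk₀ (ModuleCat.ofHom i)) (add_zero 1) = 0 :=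
    h.extClass_comp
  rw [h0, Abelian.Ext.zero_comp]

theorem subsingleton_ext_succ (hi : Function.Injective i) (he : Function.Exact i p)
    (hp : Function.Surjective p) (hY : ExtToRingVanishes R Y) {n : ℕ}
    (hX : Subsingleton (Abelian.Ext (ModuleCat.of R X) (ModuleCat.of R R) n)) :
    Subsingleton (Abelian.Ext (ModuleCat.of R Z) (ModuleCat.of R R) (1 + n)) := by
  have h := ModuleCat.shortExact_of_exact hi he hp
  refine subsingleton_of_forall_eq 0 fun z => ?_
  obtain ⟨x, rfl⟩ := Abelian.Ext.contravariant_sequence_exact₃ h _ z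
    (@Subsingleton.elim _ (hY (1 + n) (by omega)) _ _) rfl
  rw [@Subsingleton.elim _ hX x 0, Abelian.Ext.comp_zero]

theorem ExtToRingVanishes.right (hi : Function.Injective i) (he : Function.Exact i p)
    (hp : Function.Surjective p) (hX : ExtToRingVanishes R X) (hY : ExtToRingVanishes R Y)
    (hd : Function.Surjective i.dualMap) : ExtToRingVanishes R Z := by
  intro n hn
  obtain rfl | ⟨m, hm, rfl⟩ : n = 1 ∨ ∃ m, 0 < m ∧ n = 1 + m := by
    rcases n with _ | _ | m
    · omega
    · simp
    · exact .inr ⟨m + 1, by omega, by omega⟩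
  · exact subsingleton_ext_one_of_dualMap_surjective hi he hp hY hd
  · exact subsingleton_ext_succ hi he hp hY (hX m hm)

theorem ExtToRingVanishes.dualMap_surjective (hi : Function.Injective i)
    (he : Function.Exact i p) (hp : Function.Surjective p) (hZ : ExtToRingVanishes R Z) :
    Function.Surjective i.dualMap := by
  intro φ
  have h := ModuleCat.shortExact_of_exact hi he hp
  obtain ⟨y, hy⟩ := Abelian.Ext.contravariant_sequence_exact₁ h _
    (Abelian.Ext.mk₀ (ModuleCat.ofHom φ)) (add_zero 1)
    (@Subsingleton.elim _ (hZ 1 one_pos) _ _)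
  obtain ⟨ψ, rfl⟩ := (Abelian.Ext.mk₀_bijective _ _).2 y
  rw [Abelian.Ext.mk₀_comp_mk₀] at hy
  have := (Abelian.Ext.mk₀_bijective _ _).1 hy
  refine ⟨ψ.hom, ?_⟩
  ext x
  exact congrArg (fun f => f.hom x) this

theorem LinearMap.exact_dualMap (he : Function.Exact i p) (hp : Function.Surjective p) :
    Function.Exact p.dualMap i.dualMap :=
  LinearMap.exact_lcomp_of_exact_of_surjective R he hp

/-- Membership in the G-class without the finiteness condition. -/
structure IsTotallyReflexive (R : Type u) [CommRing R] (M : Type u) [AddCommGroup M]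
    [Module R M] : Prop where
  ext_vanishes : ExtToRingVanishes R M
  ext_dual_vanishes : ExtToRingVanishes R (Module.Dual R M)
  reflexive : Function.Bijective (Module.Dual.eval R M)

theorem IsGClass.isTotallyReflexive (h : IsGClass R X) : IsTotallyReflexive R X :=
  ⟨h.2, h.3, h.4⟩

theorem IsTotallyReflexive.isGClass [Module.Finite R X] (h : IsTotallyReflexive R X) :
    IsGClass R X :=
  ⟨inferInstance, h.1, h.2, h.3⟩

theorem IsTotallyReflexive.of_finite_projective [Module.Finite R X] [Module.Projective R X] :
    IsTotallyReflexive R X :=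
  ⟨.of_projective, .of_projective, Module.bijective_dual_eval R X⟩

theorem Module.Dual.eval_map_apply {R M N : Type*} [CommRing R] [AddCommGroup M] [Module R M]
    [AddCommGroup N] [Module R N] (f : M →ₗ[R] N) (x : M) :
    f.dualMap.dualMap (Module.Dual.eval R M x) = Module.Dual.eval R N (f x) := rfl

/-- Vanishing of `Ext¹(Z, R)` makes the dual sequence short exact. Biduality for `X` then follows by
a diagram chase against the double dual sequence. No finiteness is involved, so the kernel need not
be shown finitely generated. -/
theorem IsTotallyReflexive.left (hi : Function.Injective i) (he : Function.Exact i p)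
    (hp : Function.Surjective p) (hY : IsTotallyReflexive R Y) (hZ : IsTotallyReflexive R Z) :
    IsTotallyReflexive R X := by
  have hid : Function.Surjective i.dualMap := hZ.1.dualMap_surjective hi he hp
  have hpd : Function.Injective p.dualMap := LinearMap.dualMap_injective_of_surjective hp
  have hidd : Function.Injective i.dualMap.dualMap :=
    LinearMap.dualMap_injective_of_surjective hid
  refine ⟨.left hi he hp hY.1 hZ.1, .right hpd (LinearMap.exact_dualMap he hp) hid hZ.2 hY.2 ?_,
    ?_, ?_⟩
  -- Linear forms on `Z*` extend to `Y*`: each is evaluation at some `z`, and `z` lifts to `Y`.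
  · intro ζ
    obtain ⟨z, rfl⟩ := hZ.3.2 ζ
    obtain ⟨y, rfl⟩ := hp z
    exact ⟨_, Module.Dual.eval_map_apply p y⟩
  · intro x x' h
    apply hi
    apply hY.3.1
    rw [← Module.Dual.eval_map_apply, h, Module.Dual.eval_map_apply]
  · intro ξ
    obtain ⟨y, hy⟩ := hY.3.2 (i.dualMap.dualMap ξ)
    have hy0 : p y = 0 := by
      apply hZ.3.1
      rw [← Module.Dual.eval_map_apply, hy, map_zero]
      exact (LinearMap.exact_dualMap (LinearMap.exact_dualMap he hp) hid).apply_apply_eq_zero ξ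
    obtain ⟨x, rfl⟩ := (he y).1 hy0
    refine ⟨x, hidd ?_⟩
    rw [← hy, Module.Dual.eval_map_apply]

theorem IsTotallyReflexive.middle (hi : Function.Injective i) (he : Function.Exact i p)
    (hp : Function.Surjective p) (hX : IsTotallyReflexive R X) (hZ : IsTotallyReflexive R Z) :
    IsTotallyReflexive R Y := by
  have hid : Function.Surjective i.dualMap := hZ.1.dualMap_surjective hi he hp
  have hpd : Function.Injective p.dualMap := LinearMap.dualMap_injective_of_surjective hp
  have hidd : Function.Injective i.dualMap.dualMap :=
    LinearMap.dualMap_injective_of_surjective hid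
  refine ⟨.middle hi he hp hX.1 hZ.1, .middle hpd (LinearMap.exact_dualMap he hp) hid hZ.2 hX.2,
    ?_, ?_⟩
  · rw [injective_iff_map_eq_zero]
    intro y hy
    have hy0 : p y = 0 := by
      apply hZ.3.1
      rw [← Module.Dual.eval_map_apply, hy, map_zero, map_zero]
    obtain ⟨x, rfl⟩ := (he y).1 hy0
    have : x = 0 := by
      apply hX.3.1
      apply hidd
      rw [Module.Dual.eval_map_apply, hy, map_zero, map_zero]
    rw [this, map_zero]
  · intro η
    obtain ⟨z, hz⟩ := hZ.3.2 (p.dualMap.dualMap η)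
    obtain ⟨y, rfl⟩ := hp z
    have h0 : p.dualMap.dualMap (η - Module.Dual.eval R Y y) = 0 := by
      rw [map_sub, Module.Dual.eval_map_apply, hz, sub_self]
    obtain ⟨ξ, hξ⟩ := (LinearMap.exact_dualMap (LinearMap.exact_dualMap he hp) hid _).1 h0
    obtain ⟨x, rfl⟩ := hX.3.2 ξ
    refine ⟨i x + y, ?_⟩
    rw [map_add, ← Module.Dual.eval_map_apply, hξ, sub_add_cancel]

theorem IsTotallyReflexive.of_equiv (e : X ≃ₗ[R] Y) (hX : IsTotallyReflexive R X) :
    IsTotallyReflexive R Y :=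
  .middle (i := e.toLinearMap) (p := (0 : Y →ₗ[R] PUnit.{u + 1})) e.injective
    (fun y => by simp) (fun _ => ⟨0, rfl⟩) hX .of_finite_projective

theorem IsTotallyReflexive.prod (hX : IsTotallyReflexive R X) (hY : IsTotallyReflexive R Y) :
    IsTotallyReflexive R (X × Y) :=
  .middle (LinearMap.inl_injective) (Function.Exact.inl_snd) LinearMap.snd_surjective hX hY

end ShortExact

/-! ### Finite resolutions, syzygies and G-dimension -/

section Resolution

/-- `HasResolution P n M` means that there is an exact sequence
`0 → G n → ⋯ → G 0 → M → 0` of `R`-modules in which every `G k` satisfies `P`. -/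
inductive HasResolution {R : Type u} [CommRing R]
    (P : ∀ (M : Type u) [AddCommGroup M] [Module R M], Prop) :
    ℕ → ∀ (M : Type u) [AddCommGroup M] [Module R M], Prop
  | base (M : Type u) [AddCommGroup M] [Module R M] (hM : P M) : HasResolution P 0 M
  | step (n : ℕ) (K G M : Type u) [AddCommGroup K] [Module R K] [AddCommGroup G] [Module R G]
      [AddCommGroup M] [Module R M] (i : K →ₗ[R] G) (p : G →ₗ[R] M)
      (hi : Function.Injective i) (he : Function.Exact i p) (hp : Function.Surjective p)
      (hG : P G) (hK : HasResolution P n K) : HasResolution P (n + 1) M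

variable {R : Type u} [CommRing R] {K L F G M N : Type u} [AddCommGroup K] [Module R K]
  [AddCommGroup L] [Module R L] [AddCommGroup F] [Module R F] [AddCommGroup G] [Module R G]
  [AddCommGroup M] [Module R M] [AddCommGroup N] [Module R N]

/-- If `K → G → M` and `L → F → M` are short exact and `F` is projective, then there is a
surjection `K × F → G` with kernel `L`. -/
theorem exists_exact_prod_of_exact [Module.Projective R F] {i : K →ₗ[R] G} {p : G →ₗ[R] M}
    (hi : Function.Injective i) (he : Function.Exact i p) (hp : Function.Surjective p)
    {j : L →ₗ[R] F} {q : F →ₗ[R] M}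
    (hj : Function.Injective j) (he' : Function.Exact j q) (hq : Function.Surjective q) :
    ∃ (a : L →ₗ[R] K × F) (b : K × F →ₗ[R] G), Function.Injective a ∧ Function.Exact a b ∧
      Function.Surjective b := by
  obtain ⟨s, hs⟩ := Module.projective_lifting_property p q hp
  have hs' : ∀ x, p (s x) = q x := fun x => LinearMap.congr_fun hs x
  have hker : ∀ l, ∃ k, i k = - s (j l) := fun l => (he _).1 (by
    rw [map_neg, hs', he'.apply_apply_eq_zero, neg_zero])
  choose t ht using hker
  let t' : L →ₗ[R] K :=
    { toFun := t
      map_add' := fun x y => hi (by simp only [map_add, ht]; abel)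
      map_smul' := fun r x => hi (by simp [map_smul, ht]) }
  have ht' : ∀ l, i (t' l) = - s (j l) := ht
  refine ⟨t'.prod j, i.coprod s, fun x y h => hj (Prod.ext_iff.1 h).2, ?_, ?_⟩
  · rintro ⟨k, x⟩
    constructor
    · intro h
      have h' : i k + s x = 0 := h
      have hx : q x = 0 := by
        rw [← hs', eq_neg_of_add_eq_zero_right h', map_neg, he.apply_apply_eq_zero, neg_zero]
      obtain ⟨l, rfl⟩ := (he' x).1 hx
      refine ⟨l, Prod.ext (hi ?_) rfl⟩
      change i (t' l) = i k
      rw [ht', eq_neg_of_add_eq_zero_left h']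
    · rintro ⟨l, hl⟩
      obtain ⟨rfl, rfl⟩ := Prod.ext_iff.1 hl
      change i (t' l) + s (j l) = 0
      rw [ht', neg_add_cancel]
  · intro g
    obtain ⟨x, hx⟩ := hq (p g)
    obtain ⟨k, hk⟩ := (he (g - s x)).1 (by rw [map_sub, hs', hx, sub_self])
    exact ⟨(k, x), by simp [hk]⟩

/-- Only the first term `G'` of the resolution of `K` changes. The kernel `Q` of the surjection `G'
× F → K × F → G` is totally reflexive and maps onto `L` with kernel `K'`, so the tail and the length
are kept. -/
theorem HasResolution.of_exact_left {n : ℕ} (h : HasResolution (IsTotallyReflexive R) n K)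
    {a : L →ₗ[R] K × F} {b : K × F →ₗ[R] G} (hF : IsTotallyReflexive R F)
    (hG : IsTotallyReflexive R G) (ha : Function.Injective a) (he : Function.Exact a b)
    (hb : Function.Surjective b) : HasResolution (IsTotallyReflexive R) n L := by
  induction h with
  | base K hK => exact .base _ (.left ha he hb (hK.prod hF) hG)
  | step n K' G' K i p hi hip hp hG' hK' ih =>
    let c : G' × F →ₗ[R] K × F := p.prodMap LinearMap.id
    have hc : ∀ x, c x = (p x.1, x.2) := fun _ => rfl
    have hcs : Function.Surjective c := fun x => by
      obtain ⟨y, hy⟩ := hp x.1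
      exact ⟨(y, x.2), Prod.ext hy rfl⟩
    let e : L ≃ₗ[R] LinearMap.ker b :=
      (LinearEquiv.ofInjective a ha).trans (LinearEquiv.ofEq _ _ he.linearMap_ker_eq.symm)
    have hel : ∀ l, (e l : K × F) = a l := fun _ => rfl
    let Q := LinearMap.ker (b ∘ₗ c)
    have hQ : IsTotallyReflexive R Q :=
      .left (Subtype.val_injective) (LinearMap.exact_subtype_ker_map (b ∘ₗ c)) (hb.comp hcs)
        (hG'.prod hF) hG
    let π : Q →ₗ[R] L := e.symm.toLinearMap ∘ₗ
      (c ∘ₗ Q.subtype).codRestrict (LinearMap.ker b) (fun x => x.2)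
    have hπ : ∀ x : Q, a (π x) = c x := fun x => by
      rw [← hel]
      change ((e (e.symm _) : LinearMap.ker b) : K × F) = _
      rw [e.apply_symm_apply]
      rfl
    let ι : K' →ₗ[R] Q := (LinearMap.inl R G' F ∘ₗ i).codRestrict Q (fun x => by
      change b (c (i x, 0)) = 0
      rw [hc]
      simp [hip.apply_apply_eq_zero, ← Prod.zero_eq_mk])
    have hι : ∀ x, (ι x : G' × F) = (i x, 0) := fun _ => rfl
    refine .step n K' Q L ι π ?_ ?_ ?_ hQ hK'
    · intro x y h
      exact hi (Prod.ext_iff.1 (congrArg Subtype.val h)).1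
    · intro x
      rw [← map_eq_zero_iff a ha, hπ, hc, Prod.mk_eq_zero, hip]
      constructor
      · rintro ⟨⟨k, hk⟩, hx⟩
        exact ⟨k, Subtype.ext (Prod.ext hk hx.symm)⟩
      · rintro ⟨k, rfl⟩
        exact ⟨⟨k, rfl⟩, rfl⟩
    · intro l
      obtain ⟨x, hx⟩ := hcs (a l)
      have : x ∈ Q := by
        change b (c x) = 0
        rw [hx, he.apply_apply_eq_zero]
      exact ⟨⟨x, this⟩, ha (by rw [hπ, hx])⟩

/-- A syzygy of a module with a finite resolution by totally reflexive modules has a shorter such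
resolution. -/
theorem HasResolution.syzygy [Module.Finite R F] [Module.Projective R F] {n : ℕ}
    (h : HasResolution (IsTotallyReflexive R) (n + 1) M)
    {j : L →ₗ[R] F} {q : F →ₗ[R] M}
    (hj : Function.Injective j) (he' : Function.Exact j q) (hq : Function.Surjective q) :
    HasResolution (IsTotallyReflexive R) n L := by
  cases h with
  | step _ K G _ i p hi he hp hG hK =>
    obtain ⟨a, b, ha, hab, hb⟩ := exists_exact_prod_of_exact hi he hp hj he' hq
    exact hK.of_exact_left .of_finite_projective hG ha hab hb

/-- The G-resolution of the kernel of the augmentation of a G-resolution. -/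
def GResolution.tail (X : GResolution R M) : GResolution R (LinearMap.ker X.ε) where
  X n := X.X (n + 1)
  isGClass n := X.isGClass (n + 1)
  d n := X.d (n + 1)
  ε := (X.d 0).codRestrict _ fun x => X.exact_ε.apply_apply_eq_zero x
  exact_d n := X.exact_d (n + 1)
  exact_ε := fun x => by rw [← X.exact_d 0 x, ← Subtype.coe_inj]; rfl
  surjective_ε := fun x => by
    obtain ⟨y, hy⟩ := (X.exact_ε x).1 x.2
    exact ⟨y, Subtype.ext hy⟩

theorem GResolution.hasResolution (n : ℕ) : ∀ (M : Type u) [AddCommGroup M] [Module R M]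
    (X : GResolution R M) (_ : ∀ k, n < k → Subsingleton (X.X k)),
    HasResolution (IsTotallyReflexive R) n M := by
  induction n with
  | zero =>
    intro M _ _ X hX
    refine .base _ ((X.isGClass 0).isTotallyReflexive.of_equiv
      (LinearEquiv.ofBijective X.ε ⟨?_, X.surjective_ε⟩))
    have := hX 1 one_pos
    rw [injective_iff_map_eq_zero]
    intro x hx
    obtain ⟨y, rfl⟩ := (X.exact_ε x).1 hx
    rw [Subsingleton.elim y 0, map_zero]
  | succ n ih =>
    intro M _ _ X hX
    exact .step n _ _ _ (LinearMap.ker X.ε).subtype X.ε Subtype.val_injective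
      (LinearMap.exact_subtype_ker_map _) X.surjective_ε (X.isGClass 0).isTotallyReflexive
      (ih _ X.tail fun k hk => hX (k + 1) (by omega))

theorem exists_hasResolution_of_gDim_lt_top (h : gDim R M < ⊤) :
    ∃ n, HasResolution (IsTotallyReflexive R) n M := by
  obtain ⟨X, hX⟩ := iInf_lt_iff.1 h
  obtain ⟨n, hn⟩ := ENat.ne_top_iff_exists.1 hX.ne
  refine ⟨n, X.hasResolution n M fun k hk => ?_⟩
  by_contra hne
  rw [not_subsingleton_iff_nontrivial] at hne
  have : (k : ℕ∞) ≤ X.length := le_iSup₂_of_le (f := fun (n : ℕ) (_ : Nontrivial (X.X n)) =>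
    (n : ℕ∞)) k hne le_rfl
  rw [← hn, Nat.cast_le] at this
  omega

/-- A module in the G-class, as a G-resolution of itself. -/
noncomputable def IsGClass.resolution (hM : IsGClass R M) (e : M ≃ₗ[R] N) :
    GResolution R N where
  X
    | 0 => ModuleCat.of R M
    | _ + 1 => ModuleCat.of R PUnit
  isGClass
    | 0 => hM
    | _ + 1 => IsTotallyReflexive.of_finite_projective.isGClass
  d
    | 0 => 0
    | _ + 1 => 0
  ε := e.toLinearMap
  exact_d
    | 0 => fun x => by simp
    | _ + 1 => fun x => by simp
  exact_ε := fun x => ((map_eq_zero_iff e e.injective).trans eq_comm).trans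
    ⟨fun h => ⟨0, h⟩, fun ⟨_, h⟩ => h⟩
  surjective_ε := e.surjective

/-- Splicing a G-resolution of `K` with a short exact sequence `K → G → M`. -/
noncomputable def GResolution.cons (X : GResolution R K) (hG : IsGClass R G) {i : K →ₗ[R] G}
    {p : G →ₗ[R] M} (hi : Function.Injective i) (he : Function.Exact i p)
    (hp : Function.Surjective p) : GResolution R M where
  X
    | 0 => ModuleCat.of R G
    | n + 1 => X.X n
  isGClass
    | 0 => hG
    | n + 1 => X.isGClass n
  d
    | 0 => i ∘ₗ X.ε
    | n + 1 => X.d n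
  ε := p
  exact_d
    | 0 => fun x => by
      rw [← X.exact_ε x]
      exact map_eq_zero_iff i hi
    | n + 1 => X.exact_d n
  exact_ε := fun x => by
    rw [he x]
    constructor
    · rintro ⟨k, rfl⟩
      obtain ⟨y, rfl⟩ := X.surjective_ε k
      exact ⟨y, rfl⟩
    · rintro ⟨y, rfl⟩
      exact ⟨X.ε y, rfl⟩
  surjective_ε := hp

theorem HasResolution.exists_gResolution {n : ℕ} (h : HasResolution (IsGClass R) n M) :
    ∃ X : GResolution R M, ∀ k, n < k → Subsingleton (X.X k) := by
  induction h with
  | base M hM =>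
    refine ⟨hM.resolution (LinearEquiv.refl R M), fun k hk => ?_⟩
    cases k with
    | zero => omega
    | succ k => exact inferInstanceAs (Subsingleton PUnit)
  | step n K G M i p hi he hp hG _ ih =>
    obtain ⟨X, hX⟩ := ih
    refine ⟨X.cons hG hi he hp, fun k hk => ?_⟩
    cases k with
    | zero => omega
    | succ k => exact hX k (by omega)

theorem HasResolution.gDim_lt_top {n : ℕ} (h : HasResolution (IsGClass R) n M) :
    gDim R M < ⊤ := by
  obtain ⟨X, hX⟩ := h.exists_gResolution
  refine iInf_lt_iff.2 ⟨X, lt_of_le_of_lt (iSup₂_le fun k hk => ?_) (ENat.natCast_lt_top n)⟩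
  rw [Nat.cast_le]
  by_contra hlt
  exact not_subsingleton_iff_nontrivial.2 hk (hX k (by omega))

/-- Transport of a G-resolution along an isomorphism. -/
def GResolution.ofEquiv (X : GResolution R M) (e : M ≃ₗ[R] N) : GResolution R N where
  X := X.X
  isGClass := X.isGClass
  d := X.d
  ε := e.toLinearMap ∘ₗ X.ε
  exact_d := X.exact_d
  exact_ε := fun x => by
    rw [← X.exact_ε x]
    exact map_eq_zero_iff e e.injective
  surjective_ε := e.surjective.comp X.surjective_ε

theorem gDim_lt_top_of_equiv (e : M ≃ₗ[R] N) (h : gDim R M < ⊤) : gDim R N < ⊤ := by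
  obtain ⟨X, hX⟩ := iInf_lt_iff.1 h
  exact iInf_lt_iff.2 ⟨X.ofEquiv e, hX⟩

end Resolution

/-! ### Finitely presented modules over coherent rings -/

section Coherent

theorem Module.finitePresentation_of_injective {R : Type*} [CommRing R] {N F : Type*}
    [AddCommGroup N] [Module R N] [Module.Finite R N] [AddCommGroup F] [Module R F]
    (hF : ∀ P : Submodule R F, P.FG → Module.FinitePresentation R P) (f : N →ₗ[R] F)
    (hf : Function.Injective f) : Module.FinitePresentation R N :=
  have := hF (LinearMap.range f) (Module.Finite.iff_fg.1 (Module.Finite.range f))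
  .of_equiv (LinearEquiv.ofInjective f hf).symm

/-- The image of `q` is a finitely generated ideal, hence finitely presented. So `ker q` is finitely
generated; it embeds in `F` through `t`, and `N` is an extension of finitely presented modules. -/
theorem IsCoherentRing.finitePresentation_of_injective_prod {R : Type u} [CommRing R]
    (hR : IsCoherentRing R) {N F : Type*} [AddCommGroup N] [Module R N] [Module.Finite R N]
    [AddCommGroup F] [Module R F] (hF : ∀ P : Submodule R F, P.FG → Module.FinitePresentation R P)
    (q : N →ₗ[R] R) (t : N →ₗ[R] F) (h : ∀ x, q x = 0 → t x = 0 → x = 0) :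
    Module.FinitePresentation R N := by
  have : Module.FinitePresentation R (LinearMap.range q) :=
    hR _ (Module.Finite.iff_fg.1 (Module.Finite.range q))
  have : Module.Finite R (LinearMap.ker q.rangeRestrict) :=
    .of_fg (Module.FinitePresentation.fg_ker _ q.surjective_rangeRestrict)
  have : Module.FinitePresentation R (LinearMap.ker q.rangeRestrict) :=
    Module.finitePresentation_of_injective hF (t ∘ₗ Submodule.subtype _)
      ((injective_iff_map_eq_zero _).2 fun x hx =>
        Subtype.ext (h x (congrArg Subtype.val x.2) hx))
  exact Module.finitePresentation_of_ker q.rangeRestrict q.surjective_rangeRestrict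

theorem IsCoherentRing.finitePresentation_of_fg_pi {R : Type u} [CommRing R]
    (hR : IsCoherentRing R) (n : ℕ) (N : Submodule R (Fin n → R)) (hN : N.FG) :
    Module.FinitePresentation R N := by
  induction n with
  | zero => infer_instance
  | succ n ih =>
    have : Module.Finite R N := .of_fg hN
    refine hR.finitePresentation_of_injective_prod ih (LinearMap.proj 0 ∘ₗ N.subtype)
      (LinearMap.funLeft R R Fin.succ ∘ₗ N.subtype) fun x h0 hx => ?_
    ext k
    exact Fin.cases h0 (fun k => congrFun hx k) k

variable {A : Type u} [CommRing A]

theorem IsCoherentRing.finitePresentation_of_injective_pi (hA : IsCoherentRing A) {n : ℕ}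
    {N : Type*} [AddCommGroup N] [Module A N] [Module.Finite A N] (f : N →ₗ[A] Fin n → A)
    (hf : Function.Injective f) : Module.FinitePresentation A N :=
  Module.finitePresentation_of_injective (hA.finitePresentation_of_fg_pi n) f hf

/-- Over a coherent ring a finitely presented module is the quotient of a finite free module by
a finitely presented submodule. -/
theorem IsCoherentRing.exists_syzygy (hA : IsCoherentRing A) (M : Type u) [AddCommGroup M]
    [Module A M] [Module.FinitePresentation A M] :
    ∃ (n : ℕ) (q : (Fin n → A) →ₗ[A] M), Function.Surjective q ∧
      Module.FinitePresentation A (LinearMap.ker q) := by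
  obtain ⟨n, q, hq⟩ := Module.Finite.exists_fin' A M
  have : Module.Finite A (LinearMap.ker q) := .of_fg (Module.FinitePresentation.fg_ker q hq)
  exact ⟨n, q, hq, hA.finitePresentation_of_injective_pi (LinearMap.ker q).subtype
    Subtype.val_injective⟩

/-- Dualizing a finite free presentation embeds `M*` in `Aⁿ` as the kernel of the transposed matrix
`t`. The image of `t` is finitely presented by coherence, so this kernel is finitely generated, and
coherence applies again. -/
theorem IsCoherentRing.finitePresentation_dual (hA : IsCoherentRing A) (M : Type u)
    [AddCommGroup M] [Module A M] [Module.FinitePresentation A M] :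
    Module.FinitePresentation A (Module.Dual A M) := by
  obtain ⟨n, q, hq, hK⟩ := hA.exists_syzygy M
  obtain ⟨m, r, hr⟩ := Module.Finite.exists_fin' A (LinearMap.ker q)
  let s : (Fin m → A) →ₗ[A] (Fin n → A) := (LinearMap.ker q).subtype ∘ₗ r
  have hs : Function.Exact s q := by
    intro x
    constructor
    · intro h
      obtain ⟨y, hy⟩ := hr ⟨x, h⟩
      exact ⟨y, congrArg Subtype.val hy⟩
    · rintro ⟨y, rfl⟩
      exact (r y).2
  let e (k : ℕ) : Module.Dual A (Fin k → A) ≃ₗ[A] (Fin k → A) :=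
    (Pi.basisFun A (Fin k)).toDualEquiv.symm
  let t : (Fin n → A) →ₗ[A] (Fin m → A) :=
    (e m).toLinearMap ∘ₗ s.dualMap ∘ₗ (e n).symm.toLinearMap
  let r : Module.Dual A M →ₗ[A] (Fin n → A) := (e n).toLinearMap ∘ₗ q.dualMap
  have hr : Function.Injective r :=
    (e n).injective.comp (LinearMap.dualMap_injective_of_surjective hq)
  have hrt : Function.Exact r t := by
    intro x
    obtain ⟨x, rfl⟩ := (e n).surjective x
    have h₁ : t (e n x) = e m (s.dualMap x) := by simp [t]
    rw [h₁, map_eq_zero_iff (e m) (e m).injective, LinearMap.exact_dualMap hs hq x]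
    exact exists_congr fun y => (e n).injective.eq_iff.symm
  have : Module.FinitePresentation A (LinearMap.range t) :=
    hA.finitePresentation_of_fg_pi m _ (Module.Finite.iff_fg.1 (Module.Finite.range t))
  have hfg : (LinearMap.ker t.rangeRestrict).FG :=
    Module.FinitePresentation.fg_ker _ t.surjective_rangeRestrict
  rw [LinearMap.ker_rangeRestrict, hrt.linearMap_ker_eq] at hfg
  have : Module.Finite A (LinearMap.range r) := .of_fg hfg
  have : Module.Finite A (Module.Dual A M) := .equiv (LinearEquiv.ofInjective r hr).symm
  exact hA.finitePresentation_of_injective_pi r hr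

/-- `Ext` into the ring vanishes in positive degrees for every module in a class in which each
module has a syzygy in the class such that linear forms on the syzygy extend. -/
theorem ExtToRingVanishes.of_forall_exists_syzygy
    (P : ∀ (M : Type u) [AddCommGroup M] [Module A M], Prop)
    (hP : ∀ (M : Type u) [AddCommGroup M] [Module A M], P M →
      ∃ (K F : Type u) (_ : AddCommGroup K) (_ : Module A K) (_ : AddCommGroup F)
        (_ : Module A F) (i : K →ₗ[A] F) (p : F →ₗ[A] M), Module.Projective A F ∧
        Function.Injective i ∧ Function.Exact i p ∧ Function.Surjective p ∧
        Function.Surjective i.dualMap ∧ P K)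
    {M : Type u} [AddCommGroup M] [Module A M] (hM : P M) : ExtToRingVanishes A M := by
  intro n hn
  obtain ⟨n, rfl⟩ := Nat.exists_eq_succ_of_ne_zero hn.ne'
  clear hn
  induction n generalizing M with
  | zero =>
    obtain ⟨K, F, _, _, _, _, i, p, hF, hi, he, hp, hd, -⟩ := hP M hM
    exact subsingleton_ext_one_of_dualMap_surjective hi he hp .of_projective hd
  | succ n ih =>
    obtain ⟨K, F, _, _, _, _, i, p, hF, hi, he, hp, hd, hK⟩ := hP M hM
    rw [Nat.succ_eq_add_one, add_comm]
    exact subsingleton_ext_succ hi he hp .of_projective (ih hK)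

end Coherent

/-! ### Flat base change of the G-class and of finite G-dimension -/

section FlatBaseChange

variable {A : Type u} [CommRing A] {B : Type (max u v)} [CommRing B] [Algebra A B]
  [Module.Flat A B]

theorem LinearMap.exact_baseChange {A : Type*} [CommRing A] (B : Type*) [CommRing B] [Algebra A B]
    {K F M : Type*} [AddCommGroup K] [Module A K] [AddCommGroup F]
    [Module A F] [AddCommGroup M] [Module A M] {i : K →ₗ[A] F} {p : F →ₗ[A] M}
    (he : Function.Exact i p) (hp : Function.Surjective p) :
    Function.Exact (i.baseChange B) (p.baseChange B) :=
  lTensor_exact B he hp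

/-- Let `B` be flat over `A` and `i : K → F` a map of `A`-modules such that linear forms on
`K` extend along `i`. If `K` is finitely presented, the same holds for the base change of `i`. -/
theorem LinearMap.dualMap_baseChange_surjective {K F : Type*} [AddCommGroup K] [Module A K]
    [AddCommGroup F] [Module A F] [Module.FinitePresentation A K] {i : K →ₗ[A] F}
    (hi : Function.Surjective i.dualMap) : Function.Surjective (i.baseChange B).dualMap := by
  intro φ
  let φ₀ : K →ₗ[A] B := φ.restrictScalars A ∘ₗ TensorProduct.mk A B K 1
  -- By flatness, a map from a finitely presented module to `B` factors through a finite free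
  -- `A`-module; the coordinates of the first factor are forms on `K`, which extend to `F`.
  obtain ⟨k, g, h, hgh⟩ := Module.Flat.exists_factorization_of_finitePresentation φ₀
  choose ψ hψ using fun j : Fin k => hi (Finsupp.lapply j ∘ₗ g)
  let g' : F →ₗ[A] (Fin k →₀ A) :=
    (Finsupp.linearEquivFunOnFinite A A (Fin k)).symm.toLinearMap ∘ₗ LinearMap.pi ψ
  have hg' : g' ∘ₗ i = g := by
    ext x j
    exact LinearMap.congr_fun (hψ j) x
  refine ⟨LinearMap.liftBaseChange B (h ∘ₗ g'), ?_⟩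
  ext x
  have := LinearMap.congr_fun hgh x
  rw [← hg'] at this
  simpa [φ₀] using this.symm

/-- Base changes of finitely presented modules with vanishing Ext form a class closed under suitable
syzygies, so dimension shifting applies; Ext groups over `A` and `B` are never compared. -/
theorem ExtToRingVanishes.tensorProduct (hA : IsCoherentRing A) {M : Type u} [AddCommGroup M]
    [Module A M] [Module.FinitePresentation A M] (hM : ExtToRingVanishes A M) :
    ExtToRingVanishes.{max u v} B (B ⊗[A] M) := by
  refine .of_forall_exists_syzygy (fun (N : Type (max u v)) _ _ =>
    ∃ (M : Type u) (_ : AddCommGroup M) (_ : Module A M), Module.FinitePresentation A M ∧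
      ExtToRingVanishes A M ∧ Nonempty (B ⊗[A] M ≃ₗ[B] N)) ?_
      ⟨M, _, _, inferInstance, hM, ⟨LinearEquiv.refl B _⟩⟩
  rintro N _ _ ⟨M, _, _, _, hM, ⟨e⟩⟩
  obtain ⟨n, q, hq, hK⟩ := hA.exists_syzygy M
  have he := LinearMap.exact_subtype_ker_map q
  have hd := hM.dualMap_surjective Subtype.val_injective he hq
  refine ⟨B ⊗[A] LinearMap.ker q, B ⊗[A] (Fin n → A), inferInstance, inferInstance,
    inferInstance, inferInstance, (LinearMap.ker q).subtype.baseChange B,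
    e.toLinearMap ∘ₗ q.baseChange B, inferInstance, ?_, ?_, ?_, ?_, ?_⟩
  · exact Module.Flat.lTensor_preserves_injective_linearMap _ Subtype.val_injective
  · intro x
    rw [← LinearMap.exact_baseChange B he hq x]
    exact map_eq_zero_iff e e.injective
  · exact e.surjective.comp (LinearMap.lTensor_surjective B hq)
  · exact LinearMap.dualMap_baseChange_surjective hd
  · exact ⟨_, _, _, hK, .left Subtype.val_injective he hq .of_projective hM,
      ⟨LinearEquiv.refl B _⟩⟩

theorem ExtToRingVanishes.of_equiv {M N : Type u} [AddCommGroup M] [Module A M] [AddCommGroup N]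
    [Module A N] (e : M ≃ₗ[A] N) (hM : ExtToRingVanishes A M) : ExtToRingVanishes A N :=
  .middle (i := e.toLinearMap) (p := (0 : N →ₗ[A] PUnit.{u + 1})) e.injective
    (fun y => by simp) (fun _ => ⟨0, rfl⟩) hM .of_projective

/-- Duals of finitely presented modules commute with flat base change. -/
noncomputable def Module.Dual.tensorEquiv (A : Type*) [CommRing A] (B : Type*) [CommRing B]
    [Algebra A B] [Module.Flat A B] (M : Type*) [AddCommGroup M] [Module A M]
    [Module.FinitePresentation A M] : B ⊗[A] Module.Dual A M ≃ₗ[B] Module.Dual B (B ⊗[A] M) :=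
  (Module.FinitePresentation.isBaseChange_map A M A B).equiv ≪≫ₗ
    LinearEquiv.congrRight (TensorProduct.AlgebraTensorModule.rid A B B)

theorem Module.Dual.tensorEquiv_tmul_tmul (A : Type*) [CommRing A] (B : Type*) [CommRing B]
    [Algebra A B] [Module.Flat A B] (M : Type*) [AddCommGroup M] [Module A M]
    [Module.FinitePresentation A M] (b b' : B) (φ : Module.Dual A M) (x : M) :
    Module.Dual.tensorEquiv A B M (b ⊗ₜ φ) (b' ⊗ₜ x) = φ x • (b * b') := by
  simp only [Module.Dual.tensorEquiv, LinearEquiv.trans_apply, IsBaseChange.equiv_tmul, map_smul,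
    LinearMap.smul_apply, smul_eq_mul]
  change b * (φ x • b') = _
  rw [mul_smul_comm]

/-- Evaluation over `B` is the base change of evaluation over `A`, followed by the base change
isomorphisms for `M*` and `M`. -/
theorem Module.Dual.eval_tensorProduct_bijective (A : Type*) [CommRing A] (B : Type*) [CommRing B]
    [Algebra A B] [Module.Flat A B] (M : Type*) [AddCommGroup M] [Module A M]
    [Module.FinitePresentation A M] [Module.FinitePresentation A (Module.Dual A M)]
    (h : Function.Bijective (Module.Dual.eval A M)) :
    Function.Bijective (Module.Dual.eval B (B ⊗[A] M)) := by
  let e : B ⊗[A] M ≃ₗ[B] Module.Dual B (Module.Dual B (B ⊗[A] M)) :=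
    (LinearEquiv.ofBijective _ h).baseChange A B _ _ ≪≫ₗ Module.Dual.tensorEquiv A B _ ≪≫ₗ
      (Module.Dual.tensorEquiv A B M).symm.dualMap
  have : Module.Dual.eval B (B ⊗[A] M) = e.toLinearMap := by
    refine TensorProduct.AlgebraTensorModule.ext fun b x => ?_
    ext ξ
    obtain ⟨ξ, rfl⟩ := (Module.Dual.tensorEquiv A B M).surjective ξ
    induction ξ with
    | zero => simp
    | add ξ η hξ hη => rw [map_add, map_add, map_add, hξ, hη]
    | tmul c φ =>
      simp [e, Module.Dual.tensorEquiv_tmul_tmul, mul_comm]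
  rw [this]
  exact e.bijective

theorem IsTotallyReflexive.isGClass_tensorProduct (hA : IsCoherentRing A) {M : Type u}
    [AddCommGroup M] [Module A M] [Module.FinitePresentation A M] (hM : IsTotallyReflexive A M) :
    IsGClass.{max u v} B (B ⊗[A] M) := by
  have := hA.finitePresentation_dual M
  exact ⟨inferInstance, hM.1.tensorProduct hA,
    (hM.2.tensorProduct hA).of_equiv (Module.Dual.tensorEquiv A B M),
    Module.Dual.eval_tensorProduct_bijective A B M hM.3⟩

/-- Over a coherent ring, a resolution of a finitely presented module by totally reflexive modules
yields, after flat base change, a resolution by modules in the G-class. -/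
theorem HasResolution.tensorProduct (hA : IsCoherentRing A) (n : ℕ) :
    ∀ (M : Type u) [AddCommGroup M] [Module A M] [Module.FinitePresentation A M],
      HasResolution (IsTotallyReflexive A) n M →
      HasResolution.{max u v} (IsGClass B) n (B ⊗[A] M) := by
  induction n with
  | zero =>
    intro M _ _ _ h
    cases h with
    | base _ hM => exact .base _ (hM.isGClass_tensorProduct hA)
  | succ n ih =>
    intro M _ _ _ h
    obtain ⟨k, q, hq, hK⟩ := hA.exists_syzygy M
    have he := LinearMap.exact_subtype_ker_map q
    exact .step n _ (B ⊗[A] (Fin k → A)) _ ((LinearMap.ker q).subtype.baseChange B)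
      (q.baseChange B) (Module.Flat.lTensor_preserves_injective_linearMap _ Subtype.val_injective)
      (LinearMap.exact_baseChange B he hq) (LinearMap.lTensor_surjective B hq)
      IsTotallyReflexive.of_finite_projective.isGClass
      (ih _ (h.syzygy Subtype.val_injective he hq))

theorem gDim_tensorProduct_lt_top (hA : IsCoherentRing A) {M : Type u}
    [AddCommGroup M] [Module A M] [Module.FinitePresentation A M] (hM : gDim A M < ⊤) :
    gDim.{max u v} B (B ⊗[A] M) < ⊤ := by
  obtain ⟨n, hn⟩ := exists_hasResolution_of_gDim_lt_top hM
  exact (hn.tensorProduct hA n M).gDim_lt_top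

end FlatBaseChange

/-! ### Finitely generated ideals under localization and flat extension -/

section FinitelyGeneratedIdeals

variable {A : Type*} [CommRing A] {B : Type*} [CommRing B] [Algebra A B]

/-- The extension of an ideal along a flat algebra is its base change. -/
noncomputable def Ideal.tensorEquivMap (B : Type*) [CommRing B] [Algebra A B] [Module.Flat A B]
    (J : Ideal A) : B ⊗[A] J ≃ₗ[B] J.map (algebraMap A B) :=
  let f : B ⊗[A] J →ₗ[B] B :=
    (TensorProduct.AlgebraTensorModule.rid A B B).toLinearMap ∘ₗ J.subtype.baseChange B
  have hf : Function.Injective f := (TensorProduct.AlgebraTensorModule.rid A B B).injective.comp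
    (Module.Flat.lTensor_preserves_injective_linearMap _ Subtype.val_injective)
  have hr : LinearMap.range f = J.map (algebraMap A B) := by
    apply le_antisymm
    · rintro _ ⟨x, rfl⟩
      induction x with
      | zero => simp
      | add x y hx hy => rw [map_add]; exact add_mem hx hy
      | tmul b x =>
        have : f (b ⊗ₜ x) = b * algebraMap A B x := by
          simp [f, Algebra.smul_def, mul_comm]
        rw [this]
        exact Ideal.mul_mem_left _ _ (Ideal.mem_map_of_mem _ x.2)
    · refine Ideal.map_le_iff_le_comap.2 fun x hx => ⟨1 ⊗ₜ ⟨x, hx⟩, ?_⟩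
      simp [f, Algebra.algebraMap_eq_smul_one]
  LinearEquiv.ofInjective f hf ≪≫ₗ LinearEquiv.ofEq _ _ hr

theorem IsLocalization.exists_fg_map_eq (S : Submonoid A) [IsLocalization S B] (I : Ideal B)
    (hI : I.FG) : ∃ J : Ideal A, J.FG ∧ J.map (algebraMap A B) = I := by
  induction I, hI using Submodule.fg_induction with
  | singleton x =>
    obtain ⟨⟨a, s⟩, h⟩ := IsLocalization.surj S x
    refine ⟨Ideal.span {a}, ⟨{a}, by simp⟩, ?_⟩
    rw [Ideal.map_span, Set.image_singleton, ← h]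
    exact Ideal.span_singleton_mul_right_unit (IsLocalization.map_units B s) x
  | sup I₁ I₂ _ _ h₁ h₂ =>
    obtain ⟨J₁, hJ₁, rfl⟩ := h₁
    obtain ⟨J₂, hJ₂, rfl⟩ := h₂
    exact ⟨J₁ ⊔ J₂, Submodule.FG.sup hJ₁ hJ₂, Ideal.map_sup _ _ _⟩

theorem IsCoherentRing.of_isLocalization {A : Type u} [CommRing A] {B : Type v} [CommRing B]
    [Algebra A B] (hA : IsCoherentRing A) (S : Submonoid A) [IsLocalization S B] :
    IsCoherentRing B := by
  intro I hI
  obtain ⟨J, hJ, rfl⟩ := IsLocalization.exists_fg_map_eq S I hI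
  have := IsLocalization.flat B S
  have := hA J hJ
  exact .of_equiv (J.tensorEquivMap B)

/-- Over a coherent ring, finite G-dimension of a finitely generated ideal is inherited by its
extensions to flat algebras. -/
theorem gDim_map_lt_top {A : Type u} [CommRing A] {B : Type (max u v)} [CommRing B] [Algebra A B]
    [Module.Flat A B] (hA : IsCoherentRing A) {J : Ideal A} (hJ : J.FG) (h : gDim A J < ⊤) :
    gDim B (J.map (algebraMap A B)) < ⊤ := by
  have := hA J hJ
  exact gDim_lt_top_of_equiv (J.tensorEquivMap B) (gDim_tensorProduct_lt_top hA h)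

/-- Extensions of finitely generated ideals of a coherent Gorenstein ring to a flat local algebra
have finite G-dimension. -/
theorem IsGorensteinRing.gDim_map_lt_top {A : Type u} [CommRing A] {B : Type (max u v)}
    [CommRing B] [IsLocalRing B] [Algebra A B] [Module.Flat A B] (hA : IsCoherentRing A)
    (hG : IsGorensteinRing A) {J : Ideal A} (hJ : J.FG) :
    gDim B (J.map (algebraMap A B)) < ⊤ := by
  let p := (IsLocalRing.maximalIdeal B).comap (algebraMap A B)
  have hp : p ≠ ⊤ := Ideal.IsPrime.ne_top'
  -- The contraction `p` need not be maximal, while the hypothesis concerns maximal ideals. Elements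
  -- outside `n ⊇ p` still become units in `B`, so `B` is an algebra over the localization at `n`.
  obtain ⟨n, hn, hpn⟩ := Ideal.exists_le_maximal p hp
  have hu (s : n.primeCompl) : IsUnit (algebraMap A B s) := by
    by_contra h
    exact s.2 (hpn ((IsLocalRing.mem_maximalIdeal _).2 h))
  algebraize [IsLocalization.lift (S := Localization.AtPrime n) hu]
  have : IsScalarTower A (Localization.AtPrime n) B :=
    .of_algebraMap_eq fun x => (IsLocalization.lift_eq hu x).symm
  have : Module.Flat (Localization.AtPrime n) B :=
    (Module.flat_iff_of_isLocalization (Localization.AtPrime n) n.primeCompl B).2 ‹_›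
  have hJn : (J.map (algebraMap A (Localization.AtPrime n))).FG := hJ.map _
  have := _root_.gDim_map_lt_top.{u, v} (B := B) (hA.of_isLocalization n.primeCompl) hJn
    (hG n _ hJn)
  rwa [Ideal.map_map, ← IsScalarTower.algebraMap_eq] at this

end FinitelyGeneratedIdeals

/-! ### Direct limits along flat maps -/

section DirectLimit

variable {Λ : Type*} [Preorder Λ] [Nonempty Λ] [IsDirectedOrder Λ]
  {R : Λ → Type*} [∀ i, CommRing (R i)] {f : ∀ i j, i ≤ j → R i →+* R j}

theorem Ring.DirectLimit.exists_of_family {ι : Type*} [Finite ι]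
    (x : ι → Ring.DirectLimit R (fun i j h => f i j h)) (i : Λ) :
    ∃ (j : Λ) (_ : i ≤ j) (y : ι → R j), ∀ a, Ring.DirectLimit.of R _ j (y a) = x a := by
  choose k y hy using fun a => Ring.DirectLimit.exists_of (x a)
  obtain ⟨m, hm⟩ := Finite.exists_le k
  obtain ⟨j, hij, hmj⟩ := exists_ge_ge i m
  exact ⟨j, hij, fun a => f _ j ((hm a).trans hmj) (y a), fun a => by
    rw [Ring.DirectLimit.of_f (f := fun i j h => f i j h), hy]⟩

theorem Ring.DirectLimit.exists_fg_map_eq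
    (I : Ideal (Ring.DirectLimit R (fun i j h => f i j h))) (hI : I.FG) :
    ∃ (i : Λ) (J : Ideal (R i)), J.FG ∧ J.map (Ring.DirectLimit.of R _ i) = I := by
  obtain ⟨s, rfl⟩ := hI
  obtain ⟨i, -, y, hy⟩ := Ring.DirectLimit.exists_of_family (ι := s) (fun a => a.1)
    (Classical.arbitrary Λ)
  refine ⟨i, Ideal.span (Set.range y), Submodule.fg_span (Set.finite_range y), ?_⟩
  rw [Ideal.map_span, ← Set.range_comp]
  change Ideal.span _ = Ideal.span _
  congr 1
  have : (Ring.DirectLimit.of R (fun i j h => f i j h) i) ∘ y = Subtype.val := funext hy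
  rw [this, Subtype.range_val]

/-- By the equational criterion: a linear relation in the limit with coefficients in `R i` already
holds at some stage `k`. Flatness of `R i → R k` trivializes it there, and the trivialization is
pushed to the limit. -/
theorem Ring.DirectLimit.flat_of [DirectedSystem R (fun i j h => f i j h)]
    (hflat : ∀ i j (h : i ≤ j), (f i j h).Flat) (i : Λ) :
    (Ring.DirectLimit.of R (fun i j h => f i j h) i).Flat := by
  algebraize [Ring.DirectLimit.of R (fun i j h => f i j h) i]
  refine Module.Flat.of_forall_isTrivialRelation fun {l c x} h => ?_
  obtain ⟨j, hij, y, hy⟩ := Ring.DirectLimit.exists_of_family x i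
  have h0 : Ring.DirectLimit.of R (fun i j h => f i j h) j (∑ a, f i j hij (c a) * y a) = 0 := by
    rw [map_sum, ← h]
    refine Finset.sum_congr rfl fun a _ => ?_
    rw [map_mul, Ring.DirectLimit.of_f (f := fun i j h => f i j h), hy]
    rfl
  obtain ⟨k, hjk, hk⟩ := Ring.DirectLimit.of.zero_exact h0
  have hfk := hflat i k (hij.trans hjk)
  algebraize [f i k (hij.trans hjk)]
  obtain ⟨m, r, z, hz, hr⟩ :=
    Module.Flat.isTrivialRelation_of_sum_smul_eq_zero (R := R i) (f := c)
      (x := fun a => f j k hjk (y a)) (by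
        rw [← hk, map_sum]
        refine Finset.sum_congr rfl fun a _ => ?_
        rw [map_mul, DirectedSystem.map_map' (f := fun i j h => f i j h)]
        rfl)
  refine ⟨m, r, fun b => Ring.DirectLimit.of R _ k (z b), fun a => ?_, hr⟩
  rw [← hy, ← Ring.DirectLimit.of_f (f := fun i j h => f i j h) hjk,
    show f j k hjk (y a) = _ from hz a, map_sum]
  refine Finset.sum_congr rfl fun b _ => ?_
  rw [Algebra.smul_def, Algebra.smul_def, map_mul]
  congr 1
  exact Ring.DirectLimit.of_f (f := fun i j h => f i j h) _ _

theorem Ring.DirectLimit.isCoherentRing [DirectedSystem R (fun i j h => f i j h)]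
    (hcoh : ∀ i, IsCoherentRing (R i)) (hflat : ∀ i j (h : i ≤ j), (f i j h).Flat) :
    IsCoherentRing (Ring.DirectLimit R (fun i j h => f i j h)) := by
  intro I hI
  obtain ⟨i, J, hJ, rfl⟩ := Ring.DirectLimit.exists_fg_map_eq I hI
  have hfl := Ring.DirectLimit.flat_of hflat i
  algebraize [Ring.DirectLimit.of R (fun i j h => f i j h) i]
  have := hcoh i J hJ
  exact .of_equiv (J.tensorEquivMap (Ring.DirectLimit R (fun i j h => f i j h)))

theorem Ring.DirectLimit.isGorensteinRing [DirectedSystem R (fun i j h => f i j h)]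
    (hcoh : ∀ i, IsCoherentRing (R i)) (hgor : ∀ i, IsGorensteinRing (R i))
    (hflat : ∀ i j (h : i ≤ j), (f i j h).Flat) :
    IsGorensteinRing (Ring.DirectLimit R (fun i j h => f i j h)) := by
  intro m _ I hI
  obtain ⟨I₀, hI₀, rfl⟩ := IsLocalization.exists_fg_map_eq m.primeCompl I hI
  obtain ⟨i, J, hJ, rfl⟩ := Ring.DirectLimit.exists_fg_map_eq I₀ hI₀
  -- The composite from `R i` to the local ring is flat, so only the single ring `R i` is needed
  -- from here on.
  have hfl := (Ring.DirectLimit.flat_of hflat i).comp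
    (RingHom.flat_algebraMap_iff.2 (IsLocalization.flat (Localization.AtPrime m) m.primeCompl))
  rw [Ideal.map_map]
  generalize (algebraMap (Ring.DirectLimit R (fun i j h => f i j h))
    (Localization.AtPrime m)).comp _ = g at hfl ⊢
  algebraize [g]
  exact (hgor i).gDim_map_lt_top (hcoh i) hJ

end DirectLimit

theorem proposition5p11 {Λ : Type*} [Preorder Λ] [Nonempty Λ] [IsDirectedOrder Λ]
    (R : Λ → Type*) [∀ i, CommRing (R i)]
    (f : ∀ i j, i ≤ j → R i →+* R j) [DirectedSystem R (fun i j h => f i j h)]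
    (hcoh : ∀ i, IsCoherentRing (R i))
    (hgor : ∀ i, IsGorensteinRing (R i))
    (hflat : ∀ i j (h : i ≤ j), (f i j h).Flat) :
    IsCoherentRing (Ring.DirectLimit R (fun i j h => f i j h)) ∧
      IsGorensteinRing (Ring.DirectLimit R (fun i j h => f i j h)) := by
  exact ⟨Ring.DirectLimit.isCoherentRing hcoh hflat,
    Ring.DirectLimit.isGorensteinRing hcoh hgor hflat⟩
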